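/- Let $K$ be a field, $L$ an arbitrary Lie algebra over $K$, and $A$ an associative commutative $K$-algebra with unit. Regard $L\otimes A$ (tensor product over $K$) as a Lie algebra over $K$ with the bracket $[x\otimes a,\,y\otimes b]=[x,y]\otimes ab$. For a $K$-vector space $M$ let $S^2(M)$ be the quotient of $M\otimes M$ by the span of all $x\otimes y-y\otimes x$, and write $x\vee y$ for the class of $x\otimes y$. A Lie algebra $L$ acts on $S^2(L)$ by $[z,x\vee y]=[z,x]\vee y+x\vee[z,y]$; let $B(L)=S^2(L)/[L,S^2(L)]$ be the space of coinvariants of this action, and let $B(L,[L,L])\subseteq B(L)$ be the image in $B(L)$ of $L\vee[L,L]$, the span of all $x\vee y$ with $x\in L$, $y\in[L,L]$. **Theorem 4.1.** There is an isomorphism of $K$-vector spaces $$B(L\otimes A)\;\simeq\; B(L,[L,L])\otimes A\;\oplus\; S^2\bigl(L/[L,L]\otimes A\bigr).$$ -/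

import Mathlib

open scoped TensorProduct

/-- The submodule of `M ⊗ M` spanned by all `x ⊗ y - y ⊗ x`. -/
def symSqRel (K M : Type*) [CommRing K] [AddCommGroup M] [Module K M] :
    Submodule K (M ⊗[K] M) :=
  Submodule.span K {t | ∃ x y : M, t = x ⊗ₜ[K] y - y ⊗ₜ[K] x}

/-- The symmetric square `S²(M)`: the quotient of `M ⊗ M` by all `x ⊗ y - y ⊗ x`. -/
abbrev SymSq (K M : Type*) [CommRing K] [AddCommGroup M] [Module K M] : Type _ :=
  (M ⊗[K] M) ⧸ symSqRel K M

/-- The symmetric product `x ∨ y` in `S²(M)`. -/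
def vee (K : Type*) {M : Type*} [CommRing K] [AddCommGroup M] [Module K M] (x y : M) :
    SymSq K M :=
  (symSqRel K M).mkQ (x ⊗ₜ[K] y)

theorem vee_comm (K : Type*) {M : Type*} [CommRing K] [AddCommGroup M] [Module K M] (x y : M) :
    vee K x y = vee K y x :=
  (Submodule.Quotient.eq _).2 (Submodule.subset_span ⟨x, y, rfl⟩)

section LieAction

variable (K L : Type*) [CommRing K] [LieRing L] [LieAlgebra K L]

theorem symSqRel_le_comap (z : L) :
    symSqRel K L ≤ (symSqRel K L).comap (LieModule.toEnd K L (L ⊗[K] L) z) := by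
  refine Submodule.span_le.2 ?_
  rintro _ ⟨x, y, rfl⟩
  have h1 : ⁅z, x⁆ ⊗ₜ[K] y - y ⊗ₜ[K] ⁅z, x⁆ ∈ symSqRel K L :=
    Submodule.subset_span ⟨_, _, rfl⟩
  have h2 : x ⊗ₜ[K] ⁅z, y⁆ - ⁅z, y⁆ ⊗ₜ[K] x ∈ symSqRel K L :=
    Submodule.subset_span ⟨_, _, rfl⟩
  have h := Submodule.add_mem _ h1 h2
  simp only [SetLike.mem_coe, Submodule.mem_comap, map_sub, LieModule.toEnd_apply_apply,
    TensorProduct.LieModule.lie_tmul_right]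
  convert h using 1
  abel

/-- The action of `z : L` on `S²(L)`, induced by the action of `z` on `L ⊗ L`. -/
def symSqLie (z : L) : SymSq K L →ₗ[K] SymSq K L :=
  (symSqRel K L).mapQ (symSqRel K L) (LieModule.toEnd K L (L ⊗[K] L) z) (symSqRel_le_comap K L z)

/-- The defining formula of the action: `z · (x ∨ y) = [z, x] ∨ y + x ∨ [z, y]`. -/
theorem symSqLie_vee (z x y : L) :
    symSqLie K L z (vee K x y) = vee K ⁅z, x⁆ y + vee K x ⁅z, y⁆ := by
  simp only [symSqLie, vee, Submodule.mkQ_apply, Submodule.mapQ_apply,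
    LieModule.toEnd_apply_apply, TensorProduct.LieModule.lie_tmul_right,
    Submodule.Quotient.mk_add]

/-- `[L, S²(L)]`: the span of all `z · s` with `z ∈ L` and `s ∈ S²(L)`. -/
def lieSymSq : Submodule K (SymSq K L) :=
  Submodule.span K {t | ∃ (z : L) (s : SymSq K L), t = symSqLie K L z s}

/-- `B(L) = S²(L) / [L, S²(L)]`, the space of coinvariants of the `L`-action on `S²(L)`. -/
abbrev SymCoinv : Type _ := SymSq K L ⧸ lieSymSq K L

variable {K L} in
/-- `I ∨ J`, the subspace of `S²(L)` spanned by all `x ∨ y` with `x ∈ I` and `y ∈ J`. -/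
def veeIdeal (I J : LieIdeal K L) : Submodule K (SymSq K L) :=
  Submodule.span K {t | ∃ x ∈ I, ∃ y ∈ J, t = vee K x y}

variable {K L} in
/-- `B(I, J)` as a subspace of `B(L)`: the image of `I ∨ J` in `S²(L) / [L, S²(L)]`, that is,
`(I ∨ J + [L, S²(L)]) / [L, S²(L)]`. -/
def symCoinvIdeal (I J : LieIdeal K L) : Submodule K (SymCoinv K L) :=
  (veeIdeal I J).map (lieSymSq K L).mkQ

/-- The commutant `[L, L]`, an ideal of `L`. -/
abbrev commutant : LieIdeal K L := ⁅(⊤ : LieIdeal K L), (⊤ : LieIdeal K L)⁆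

end LieAction

/-! ### Invariant symmetric forms and coinvariants -/

section SymCoinvariants

variable {K M W : Type*} [CommRing K] [AddCommGroup W] [Module K W]

/-! In B(A ⊗ L) a bracket can be moved from one factor to the other, so as soon as one of x, y lies
in [L, L] the class of (a ⊗ x) ∨ (b ⊗ y) depends on a, b only through ab (`coinvMk_commutant_left`,
`coinvMk_commutant_right`). Choose a linear section s of L → L/[L, L] and write x' for s applied to
the class of x. Then (a ⊗ x) ∨ (b ⊗ y) = (a ⊗ x') ∨ (b ⊗ y') + R, where R depends only on ab
(`coinvMk_sub_section`). The first term comes from S²(A ⊗ L/[L, L]); R comes from A ⊗ B(L, [L, L]),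
since x ∨ y - x' ∨ y' lies in B(L, [L, L]) and x ∨ y ↦ x ∨ y - x' ∨ y' is a retraction of B(L) onto
it. Maps in both directions follow from universal properties and are checked inverse on generators.
-/

/-- The universal property of the symmetric square. -/
def symSqLift [AddCommGroup M] [Module K M] (f : M →ₗ[K] M →ₗ[K] W)
    (hf : ∀ x y, f x y = f y x) : SymSq K M →ₗ[K] W :=
  (symSqRel K M).liftQ (TensorProduct.lift f) <| Submodule.span_le.2 <| by
    rintro _ ⟨x, y, rfl⟩
    simp [hf x y]

theorem symSqLift_vee [AddCommGroup M] [Module K M] (f : M →ₗ[K] M →ₗ[K] W)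
    (hf : ∀ x y, f x y = f y x) (x y : M) : symSqLift f hf (vee K x y) = f x y := rfl

theorem symSq_hom_ext [AddCommGroup M] [Module K M] {f g : SymSq K M →ₗ[K] W}
    (h : ∀ x y, f (vee K x y) = g (vee K x y)) : f = g :=
  Submodule.linearMap_qext _ (TensorProduct.ext' h)

/-- The symmetric product as a bilinear map. -/
def veeHom (K M : Type*) [CommRing K] [AddCommGroup M] [Module K M] :
    M →ₗ[K] M →ₗ[K] SymSq K M :=
  (TensorProduct.mk K M M).compr₂ (symSqRel K M).mkQ

variable [LieRing M] [LieAlgebra K M]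

/-- The class of `x ∨ y` in the coinvariants, as a bilinear map. -/
def coinvMk (K M : Type*) [CommRing K] [LieRing M] [LieAlgebra K M] :
    M →ₗ[K] M →ₗ[K] SymCoinv K M :=
  (veeHom K M).compr₂ (lieSymSq K M).mkQ

theorem coinvMk_apply (x y : M) : coinvMk K M x y = (lieSymSq K M).mkQ (vee K x y) := rfl

theorem coinvMk_comm (x y : M) : coinvMk K M x y = coinvMk K M y x := by
  rw [coinvMk_apply, vee_comm, coinvMk_apply]

theorem coinvMk_lie (z x y : M) :
    coinvMk K M ⁅z, x⁆ y = -coinvMk K M x ⁅z, y⁆ := by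
  rw [eq_neg_iff_add_eq_zero, coinvMk_apply, coinvMk_apply, ← map_add, ← symSqLie_vee,
    Submodule.mkQ_apply, Submodule.Quotient.mk_eq_zero]
  exact Submodule.subset_span ⟨_, _, rfl⟩

/-- The universal property of the coinvariants of the symmetric square: invariant symmetric
bilinear maps factor through it. -/
def coinvLift (f : M →ₗ[K] M →ₗ[K] W) (hf : ∀ x y, f x y = f y x)
    (hinv : ∀ z x y : M, f ⁅z, x⁆ y + f x ⁅z, y⁆ = 0) : SymCoinv K M →ₗ[K] W :=
  (lieSymSq K M).liftQ (symSqLift f hf) <| Submodule.span_le.2 <| by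
    rintro _ ⟨z, s, rfl⟩
    have : symSqLift f hf ∘ₗ symSqLie K M z = 0 := symSq_hom_ext fun x y => by
      simp only [LinearMap.comp_apply, symSqLie_vee, map_add, symSqLift_vee, hinv,
        LinearMap.zero_apply]
    exact LinearMap.congr_fun this s

theorem coinvLift_mk (f : M →ₗ[K] M →ₗ[K] W) (hf : ∀ x y, f x y = f y x)
    (hinv : ∀ z x y : M, f ⁅z, x⁆ y + f x ⁅z, y⁆ = 0) (x y : M) :
    coinvLift f hf hinv (coinvMk K M x y) = f x y :=
  symSqLift_vee f hf x y

theorem coinv_hom_ext {f g : SymCoinv K M →ₗ[K] W}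
    (h : ∀ x y, f (coinvMk K M x y) = g (coinvMk K M x y)) : f = g :=
  Submodule.linearMap_qext _ (symSq_hom_ext h)

end SymCoinvariants

section Current

/-! ### Collecting coefficients in A ⊗ L -/

variable {K L A : Type*} [CommRing K] [LieRing L] [LieAlgebra K L] [CommRing A] [Algebra K A]

theorem commutant_induction {p : L → Prop} (lie : ∀ x y : L, p ⁅x, y⁆) (zero : p 0)
    (add : ∀ x y, p x → p y → p (x + y)) (smul : ∀ (c : K) x, p x → p (c • x))
    {w : L} (hw : w ∈ commutant K L) : p w := by
  rw [← LieSubmodule.mem_toSubmodule, LieSubmodule.lieIdeal_oper_eq_linear_span'] at hw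
  induction hw using Submodule.span_induction with
  | mem _ h =>
    obtain ⟨x, -, y, -, rfl⟩ := h
    exact lie x y
  | zero => exact zero
  | add x y _ _ hx hy => exact add x y hx hy
  | smul c x _ hx => exact smul c x hx

theorem lie_mem_commutant (x y : L) : ⁅x, y⁆ ∈ commutant K L :=
  LieSubmodule.lie_mem_lie (LieSubmodule.mem_top x) (LieSubmodule.mem_top y)

/-- For w = [y, z], moving y to the other factor multiplies the coefficient there, leaving an
expression in ab alone. -/
theorem coinvMk_commutant_left {w : L} (hw : w ∈ commutant K L) (a b : A) (x : L) :
    coinvMk K (A ⊗[K] L) (a ⊗ₜ w) (b ⊗ₜ x) =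
      coinvMk K (A ⊗[K] L) ((a * b) ⊗ₜ w) (1 ⊗ₜ x) := by
  refine commutant_induction (K := K) (L := L) (p := fun w =>
    coinvMk K (A ⊗[K] L) (a ⊗ₜ w) (b ⊗ₜ x) =
      coinvMk K (A ⊗[K] L) ((a * b) ⊗ₜ w) (1 ⊗ₜ x)) ?_ ?_ ?_ ?_ hw
  · intro y z
    have h (c d : A) : coinvMk K (A ⊗[K] L) (c ⊗ₜ ⁅y, z⁆) (d ⊗ₜ x) =
        -coinvMk K (A ⊗[K] L) (1 ⊗ₜ z) ((c * d) ⊗ₜ ⁅y, x⁆) := by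
      -- All of c is put on the acting element, so z keeps coefficient 1 and d becomes cd.
      have := coinvMk_lie (K := K) (c ⊗ₜ[K] y : A ⊗[K] L) (1 ⊗ₜ z) (d ⊗ₜ x)
      rwa [LieAlgebra.ExtendScalars.bracket_tmul, LieAlgebra.ExtendScalars.bracket_tmul,
        mul_one] at this
    rw [h, h, mul_one]
  · simp
  · intro u v hu hv
    simp only [TensorProduct.tmul_add, map_add, LinearMap.add_apply, hu, hv]
  · intro c u hu
    simp only [TensorProduct.tmul_smul, map_smul, LinearMap.smul_apply, hu]

theorem coinvMk_commutant_right {w : L} (hw : w ∈ commutant K L) (a b : A) (x : L) :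
    coinvMk K (A ⊗[K] L) (a ⊗ₜ x) (b ⊗ₜ w) =
      coinvMk K (A ⊗[K] L) ((a * b) ⊗ₜ x) (1 ⊗ₜ w) := by
  -- With coefficients 1 and ab, the left version carries the whole product across between x and w.
  have h := coinvMk_commutant_left hw 1 (a * b) x
  rw [coinvMk_comm, coinvMk_commutant_left hw, mul_comm b a, coinvMk_comm _ (1 ⊗ₜ w), h, one_mul]

variable (K L A) in
/-- The bilinear map `coinvMk` of `A ⊗ L`, typed with the module structure of the tensor product. -/
noncomputable def currentCoinvMk :
    (A ⊗[K] L) →ₗ[K] (A ⊗[K] L) →ₗ[K] SymCoinv K (A ⊗[K] L) :=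
  coinvMk K (A ⊗[K] L)

theorem currentCoinvMk_comm (X Y : A ⊗[K] L) :
    currentCoinvMk K L A X Y = currentCoinvMk K L A Y X :=
  coinvMk_comm X Y

/-! ### The two projections out of B(A ⊗ L) -/

variable (K L A) in
/-- The bilinear map `(a ⊗ x, b ⊗ y) ↦ ab ⊗ (x ∨ y)`. -/
noncomputable def currentForm :
    (A ⊗[K] L) →ₗ[K] (A ⊗[K] L) →ₗ[K] A ⊗[K] SymCoinv K L :=
  TensorProduct.map₂ (LinearMap.mul K A) (coinvMk K L)

theorem currentForm_tmul (a b : A) (x y : L) :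
    currentForm K L A (a ⊗ₜ x) (b ⊗ₜ y) = (a * b) ⊗ₜ coinvMk K L x y := rfl

variable (K L A) in
/-- The map `B(A ⊗ L) → A ⊗ B(L)`, `(a ⊗ x) ∨ (b ⊗ y) ↦ ab ⊗ (x ∨ y)`. -/
noncomputable def coinvCurrent : SymCoinv K (A ⊗[K] L) →ₗ[K] A ⊗[K] SymCoinv K L :=
  coinvLift (currentForm K L A)
    (fun X Y => by
      have : currentForm K L A = (currentForm K L A).flip := by
        ext a x b y
        simp [currentForm_tmul, mul_comm a b, coinvMk_comm x y]
      exact LinearMap.congr_fun₂ this X Y)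
    (fun Z X Y => by
      induction Z using TensorProduct.induction_on with
      | zero => simp
      | add Z Z' h h' =>
        rw [add_lie, add_lie, map_add, map_add, LinearMap.add_apply, add_add_add_comm, h, h',
          add_zero]
      | tmul c z =>
        induction X using TensorProduct.induction_on with
        | zero => simp
        | add X X' h h' =>
          rw [lie_add, map_add, map_add, LinearMap.add_apply, LinearMap.add_apply,
            add_add_add_comm, h, h', add_zero]
        | tmul a x =>
          induction Y using TensorProduct.induction_on with
          | zero => simp
          | add Y Y' h h' =>
            rw [lie_add, map_add, map_add, add_add_add_comm, h, h', add_zero]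
          | tmul b y =>
            -- Both terms have coefficient cab, so invariance in B(L) cancels them.
            rw [LieAlgebra.ExtendScalars.bracket_tmul, LieAlgebra.ExtendScalars.bracket_tmul,
              currentForm_tmul, currentForm_tmul, coinvMk_lie, mul_left_comm a c b, mul_assoc,
              TensorProduct.tmul_neg, neg_add_cancel])

theorem coinvCurrent_tmul (a b : A) (x y : L) :
    coinvCurrent K L A (coinvMk K _ (a ⊗ₜ x) (b ⊗ₜ y)) = (a * b) ⊗ₜ coinvMk K L x y :=
  coinvLift_mk _ _ _ _ _

theorem coinv_current_hom_ext {W : Type*} [AddCommGroup W] [Module K W]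
    {f g : SymCoinv K (A ⊗[K] L) →ₗ[K] W}
    (h : ∀ (a b : A) (x y : L), f (coinvMk K _ (a ⊗ₜ x) (b ⊗ₜ y)) =
      g (coinvMk K _ (a ⊗ₜ x) (b ⊗ₜ y))) : f = g := by
  refine coinv_hom_ext fun X Y => ?_
  have : (coinvMk K (A ⊗[K] L)).compr₂ f = (coinvMk K (A ⊗[K] L)).compr₂ g := by
    ext a x b y
    exact h a b x y
  exact LinearMap.congr_fun₂ this X Y

theorem tensor_coinv_hom_ext {W : Type*} [AddCommGroup W] [Module K W]
    {f g : A ⊗[K] SymCoinv K L →ₗ[K] W}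
    (h : ∀ (a : A) (x y : L), f (a ⊗ₜ coinvMk K L x y) = g (a ⊗ₜ coinvMk K L x y)) : f = g :=
  TensorProduct.ext <| LinearMap.ext fun a => coinv_hom_ext fun x y => h a x y

variable (K L) in
/-- The projection of a Lie algebra onto its abelianization. -/
def abMk : L →ₗ[K] L ⧸ commutant K L := (commutant K L).toSubmodule.mkQ

theorem abMk_eq_zero {w : L} : abMk K L w = 0 ↔ w ∈ commutant K L :=
  Submodule.Quotient.mk_eq_zero _

variable (K L A) in
/-- The map `B(A ⊗ L) → S²(A ⊗ L/[L, L])` induced by the projection `L → L/[L, L]`. -/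
noncomputable def coinvAb :
    SymCoinv K (A ⊗[K] L) →ₗ[K] SymSq K (A ⊗[K] (L ⧸ commutant K L)) :=
  coinvLift ((veeHom K _).compl₁₂ ((abMk K L).lTensor A) ((abMk K L).lTensor A))
    (fun _ _ => vee_comm _ _ _)
    (fun Z X Y => by
      have h (Z X : A ⊗[K] L) : (abMk K L).lTensor A ⁅Z, X⁆ = 0 := by
        induction Z using TensorProduct.induction_on with
        | zero => simp
        | add Z Z' h h' => rw [add_lie, map_add, h, h', add_zero]
        | tmul c z =>
          induction X using TensorProduct.induction_on with
          | zero => simp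
          | add X X' h h' => rw [lie_add, map_add, h, h', add_zero]
          | tmul a x =>
            rw [LieAlgebra.ExtendScalars.bracket_tmul, LinearMap.lTensor_tmul,
              abMk_eq_zero.2 (lie_mem_commutant z x), TensorProduct.tmul_zero]
      simp [h])

theorem coinvAb_tmul (a b : A) (x y : L) :
    coinvAb K L A (coinvMk K _ (a ⊗ₜ x) (b ⊗ₜ y)) =
      vee K (a ⊗ₜ abMk K L x) (b ⊗ₜ abMk K L y) :=
  coinvLift_mk _ _ _ _ _

/-! ### Splitting along a section of the abelianization -/

section Splitting

variable (s : (L ⧸ commutant K L) →ₗ[K] L) (hs : ∀ t, abMk K L (s t) = t)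

include hs in
theorem sub_section_mem (x : L) : x - s (abMk K L x) ∈ commutant K L := by
  rw [← abMk_eq_zero, map_sub, hs, sub_self]

variable (A) in
/-- The map `S²(A ⊗ L/[L, L]) → B(A ⊗ L)` induced by a linear section of `L → L/[L, L]`. -/
noncomputable def abSection :
    SymSq K (A ⊗[K] (L ⧸ commutant K L)) →ₗ[K] SymCoinv K (A ⊗[K] L) :=
  symSqLift ((currentCoinvMk K L A).compl₁₂ (s.lTensor A) (s.lTensor A))
    (fun X Y => currentCoinvMk_comm (s.lTensor A X) (s.lTensor A Y))

theorem abSection_tmul (a b : A) (x y : L ⧸ commutant K L) :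
    abSection A s (vee K (a ⊗ₜ x) (b ⊗ₜ y)) = coinvMk K _ (a ⊗ₜ s x) (b ⊗ₜ s y) :=
  symSqLift_vee _ _ _ _

theorem symSq_tensor_hom_ext {V W : Type*} [AddCommGroup V] [Module K V] [AddCommGroup W]
    [Module K W] {f g : SymSq K (A ⊗[K] V) →ₗ[K] W}
    (h : ∀ (a b : A) (x y : V), f (vee K (a ⊗ₜ x) (b ⊗ₜ y)) = g (vee K (a ⊗ₜ x) (b ⊗ₜ y))) :
    f = g := by
  refine symSq_hom_ext fun X Y => ?_
  have : (veeHom K (A ⊗[K] V)).compr₂ f = (veeHom K (A ⊗[K] V)).compr₂ g := by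
    ext a x b y
    exact h a b x y
  exact LinearMap.congr_fun₂ this X Y

variable (K L A) in
/-- The trilinear map `(x, y, a) ↦ (a ⊗ x) ∨ (1 ⊗ y)`. -/
noncomputable def unitForm : L →ₗ[K] L →ₗ[K] A →ₗ[K] SymCoinv K (A ⊗[K] L) :=
  LinearMap.mk₂ K
    (fun x y => (currentCoinvMk K L A).flip (1 ⊗ₜ y) ∘ₗ (TensorProduct.mk K A L).flip x)
    (fun _ _ _ => by ext; simp)
    (fun _ _ _ => by ext; simp)
    (fun _ _ _ => by ext; simp [TensorProduct.tmul_add])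
    (fun _ _ _ => by ext; simp)

/-- The trilinear map `(x, y, a) ↦ f x y a - f (q x) (q y) a`. -/
def subAlong {U V W : Type*} [AddCommGroup U] [Module K U] [AddCommGroup V] [Module K V]
    [AddCommGroup W] [Module K W] (f : V →ₗ[K] V →ₗ[K] U →ₗ[K] W) (q : V →ₗ[K] V) :
    V →ₗ[K] V →ₗ[K] U →ₗ[K] W :=
  f - f.compl₁₂ q q

variable (A) in
/-- The trilinear map `(x, y, a) ↦ (a ⊗ x) ∨ (1 ⊗ y) - (a ⊗ x') ∨ (1 ⊗ y')`, where `x'`, `y'` are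
the images of `x`, `y` under the projection of `L` along `[L, L]` given by a section. -/
noncomputable def splitForm : L →ₗ[K] L →ₗ[K] A →ₗ[K] SymCoinv K (A ⊗[K] L) :=
  subAlong (unitForm K L A) (s ∘ₗ abMk K L)

theorem splitForm_apply (x y : L) (a : A) :
    splitForm A s x y a = coinvMk K _ (a ⊗ₜ x) (1 ⊗ₜ y) -
      coinvMk K _ (a ⊗ₜ s (abMk K L x)) (1 ⊗ₜ s (abMk K L y)) := rfl

include hs in
-- The difference telescopes into (x - x') ∨ y + x' ∨ (y - y'); each summand has a factor in [L, L],
-- so its coefficients can be collected.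
theorem coinvMk_sub_section (a b : A) (x y : L) :
    coinvMk K (A ⊗[K] L) (a ⊗ₜ x) (b ⊗ₜ y) -
      coinvMk K _ (a ⊗ₜ s (abMk K L x)) (b ⊗ₜ s (abMk K L y)) = splitForm A s x y (a * b) := by
  have h (c d : A) : coinvMk K (A ⊗[K] L) (c ⊗ₜ x) (d ⊗ₜ y) -
      coinvMk K _ (c ⊗ₜ s (abMk K L x)) (d ⊗ₜ s (abMk K L y)) =
      coinvMk K _ (c ⊗ₜ (x - s (abMk K L x))) (d ⊗ₜ y) +
      coinvMk K _ (c ⊗ₜ s (abMk K L x)) (d ⊗ₜ (y - s (abMk K L y))) := by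
    simp only [TensorProduct.tmul_sub, map_sub, LinearMap.sub_apply]
    abel
  rw [splitForm_apply, h, h, coinvMk_commutant_left (sub_section_mem s hs x),
    coinvMk_commutant_right (sub_section_mem s hs y)]

include hs in
theorem splitForm_comm (x y : L) : splitForm A s x y = splitForm A s y x := by
  ext a
  -- The coefficient a is placed on the second factor, so that swapping the factors gives the form
  -- in the other order.
  have h := coinvMk_sub_section s hs 1 a y x
  rw [one_mul] at h
  rw [← h, splitForm_apply, coinvMk_comm (a ⊗ₜ[K] x), coinvMk_comm (a ⊗ₜ[K] s (abMk K L x))]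

/-- The action of 1 ⊗ z preserves the coefficients, and the terms in s vanish because brackets die
in L/[L, L]. -/
theorem splitForm_lie (z x y : L) : splitForm A s ⁅z, x⁆ y + splitForm A s x ⁅z, y⁆ = 0 := by
  ext a
  have h := coinvMk_lie (K := K) (1 ⊗ₜ[K] z : A ⊗[K] L) (a ⊗ₜ x) (1 ⊗ₜ y)
  rw [LieAlgebra.ExtendScalars.bracket_tmul, LieAlgebra.ExtendScalars.bracket_tmul, one_mul,
    one_mul] at h
  simp [splitForm_apply, abMk_eq_zero.2 (lie_mem_commutant z _), h]

variable (A) in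
/-- The map `A ⊗ B(L) → B(A ⊗ L)` induced by `splitForm`. -/
noncomputable def currentSection : A ⊗[K] SymCoinv K L →ₗ[K] SymCoinv K (A ⊗[K] L) :=
  TensorProduct.lift
    (coinvLift (splitForm A s) (splitForm_comm s hs) (splitForm_lie s)).flip

theorem currentSection_tmul (a : A) (x y : L) :
    currentSection A s hs (a ⊗ₜ coinvMk K L x y) = splitForm A s x y a := by
  simp [currentSection, coinvLift_mk]

theorem mem_symCoinvIdeal_of_mem_left {w : L} (hw : w ∈ commutant K L) (x : L) :
    coinvMk K L w x ∈ symCoinvIdeal (⊤ : LieIdeal K L) (commutant K L) := by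
  rw [coinvMk_comm]
  exact Submodule.mem_map_of_mem (Submodule.subset_span ⟨x, LieSubmodule.mem_top x, w, hw, rfl⟩)

/-! ### Retraction of B(L) onto B(L, [L, L]) -/

/-- The bilinear map `(x, y) ↦ x ∨ y - x' ∨ y'` on `L` with values in `B(L)`. -/
noncomputable def retractForm : L →ₗ[K] L →ₗ[K] SymCoinv K L :=
  coinvMk K L - (coinvMk K L).compl₁₂ (s ∘ₗ abMk K L) (s ∘ₗ abMk K L)

theorem retractForm_apply (x y : L) : retractForm s x y =
    coinvMk K L x y - coinvMk K L (s (abMk K L x)) (s (abMk K L y)) := rfl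

/-- The endomorphism `x ∨ y ↦ x ∨ y - x' ∨ y'` of `B(L)`. -/
noncomputable def retractEnd : SymCoinv K L →ₗ[K] SymCoinv K L :=
  coinvLift (retractForm s)
    (fun x y => by
      rw [retractForm_apply, coinvMk_comm, coinvMk_comm (s _), retractForm_apply])
    (fun z x y => by
      simp [retractForm_apply, abMk_eq_zero.2 (lie_mem_commutant z _), coinvMk_lie])

theorem retractEnd_mk (x y : L) : retractEnd s (coinvMk K L x y) =
    coinvMk K L x y - coinvMk K L (s (abMk K L x)) (s (abMk K L y)) :=
  coinvLift_mk _ _ _ _ _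

include hs in
theorem retractEnd_mem (t : SymCoinv K L) :
    retractEnd s t ∈ symCoinvIdeal (⊤ : LieIdeal K L) (commutant K L) := by
  set N := symCoinvIdeal (⊤ : LieIdeal K L) (commutant K L)
  have : N.mkQ ∘ₗ retractEnd s = 0 := coinv_hom_ext fun x y => by
    rw [LinearMap.comp_apply, LinearMap.zero_apply, Submodule.mkQ_apply,
      Submodule.Quotient.mk_eq_zero, retractEnd_mk]
    have h : coinvMk K L x y - coinvMk K L (s (abMk K L x)) (s (abMk K L y)) =
        coinvMk K L (x - s (abMk K L x)) y +
          coinvMk K L (y - s (abMk K L y)) (s (abMk K L x)) := by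
      rw [coinvMk_comm (y - _)]
      simp only [map_sub, LinearMap.sub_apply]
      abel
    rw [h]
    exact N.add_mem (mem_symCoinvIdeal_of_mem_left (sub_section_mem s hs x) _)
      (mem_symCoinvIdeal_of_mem_left (sub_section_mem s hs y) _)
  exact (Submodule.Quotient.mk_eq_zero N).1 (LinearMap.congr_fun this t)

/-- A linear retraction of `B(L)` onto `B(L, [L, L])`. -/
noncomputable def retract :
    SymCoinv K L →ₗ[K] symCoinvIdeal (⊤ : LieIdeal K L) (commutant K L) :=
  (retractEnd s).codRestrict _ (retractEnd_mem s hs)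

theorem retract_comp_subtype :
    retract s hs ∘ₗ (symCoinvIdeal (⊤ : LieIdeal K L) (commutant K L)).subtype = .id := by
  have h : symCoinvIdeal (⊤ : LieIdeal K L) (commutant K L) ≤
      LinearMap.eqLocus (retractEnd s) .id := by
    refine Submodule.map_le_iff_le_comap.2 (Submodule.span_le.2 ?_)
    rintro _ ⟨x, -, w, hw, rfl⟩
    have := retractEnd_mk s x w
    -- The second factor is in [L, L], so the correction term is zero.
    rw [abMk_eq_zero.2 hw, map_zero, map_zero, sub_zero] at this
    exact this
  ext t
  exact congrArg _ (Subtype.ext (h t.2))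

include hs in
theorem retractEnd_section (x y : L ⧸ commutant K L) :
    retractEnd s (coinvMk K L (s x) (s y)) = 0 := by
  rw [retractEnd_mk, hs, hs, sub_self]

theorem retract_section (x y : L ⧸ commutant K L) :
    retract s hs (coinvMk K L (s x) (s y)) = 0 :=
  Subtype.ext (retractEnd_section s hs x y)

include hs in
theorem splitForm_section (x y : L ⧸ commutant K L) :
    splitForm A s (s x) (s y) = 0 := by
  ext a
  rw [splitForm_apply, hs, hs, sub_self, LinearMap.zero_apply]

/-- Given a linear section of `L → L/[L, L]`, the space `B(A ⊗ L)` splits as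
`A ⊗ B(L, [L, L]) ⊕ S²(A ⊗ L/[L, L])`. -/
noncomputable def coinvCurrentEquiv : SymCoinv K (A ⊗[K] L) ≃ₗ[K]
    ((A ⊗[K] (symCoinvIdeal (⊤ : LieIdeal K L) (commutant K L))) ×
      SymSq K (A ⊗[K] (L ⧸ commutant K L))) :=
  -- Retracting changes x ∨ y only by x' ∨ y', which `currentSection` kills since x'' = x'.
  have hretract : currentSection A s hs ∘ₗ
      (symCoinvIdeal (⊤ : LieIdeal K L) (commutant K L)).subtype.lTensor A ∘ₗ
      (retract s hs).lTensor A = currentSection A s hs :=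
    tensor_coinv_hom_ext fun a x y => by
      have h : ((retract s hs (coinvMk K L x y) :) : SymCoinv K L) = _ := retractEnd_mk s x y
      simp only [LinearMap.comp_apply, LinearMap.lTensor_tmul, Submodule.subtype_apply, h]
      rw [TensorProduct.tmul_sub, map_sub, currentSection_tmul, currentSection_tmul,
        splitForm_section s hs, LinearMap.zero_apply, sub_zero]
  have hAb : coinvAb K L A ∘ₗ currentSection A s hs = 0 :=
    tensor_coinv_hom_ext fun a x y => by
      rw [LinearMap.comp_apply, currentSection_tmul, splitForm_apply, map_sub, coinvAb_tmul,
        coinvAb_tmul, hs, hs, sub_self, LinearMap.zero_apply]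
  have hAbSection : coinvAb K L A ∘ₗ abSection A s = .id :=
    symSq_tensor_hom_ext fun a b x y => by
      rw [LinearMap.comp_apply, abSection_tmul, coinvAb_tmul, hs, hs, LinearMap.id_apply]
  have hCurrent : (retract s hs).lTensor A ∘ₗ coinvCurrent K L A ∘ₗ currentSection A s hs =
      (retract s hs).lTensor A :=
    tensor_coinv_hom_ext fun a x y => by
      rw [LinearMap.comp_apply, LinearMap.comp_apply, currentSection_tmul, splitForm_apply,
        map_sub, coinvCurrent_tmul, coinvCurrent_tmul, mul_one, map_sub, LinearMap.lTensor_tmul,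
        LinearMap.lTensor_tmul, retract_section, TensorProduct.tmul_zero, sub_zero]
  have hCurrentAb : (retract s hs).lTensor A ∘ₗ coinvCurrent K L A ∘ₗ abSection A s = 0 :=
    symSq_tensor_hom_ext fun a b x y => by
      rw [LinearMap.comp_apply, LinearMap.comp_apply, abSection_tmul, coinvCurrent_tmul,
        LinearMap.lTensor_tmul, retract_section, TensorProduct.tmul_zero, LinearMap.zero_apply]
  -- This is the decomposition of a generator into its ab-dependent remainder and its abelian part.
  have hsplit : currentSection A s hs ∘ₗ coinvCurrent K L A +
      abSection A s ∘ₗ coinvAb K L A = .id :=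
    coinv_current_hom_ext fun a b x y => by
      rw [LinearMap.add_apply, LinearMap.comp_apply, LinearMap.comp_apply, coinvCurrent_tmul,
        coinvAb_tmul, currentSection_tmul, abSection_tmul, ← coinvMk_sub_section s hs,
        sub_add_cancel, LinearMap.id_apply]
  have hsub : (retract s hs).lTensor A ∘ₗ
      (symCoinvIdeal (⊤ : LieIdeal K L) (commutant K L)).subtype.lTensor A = .id := by
    rw [← LinearMap.lTensor_comp, retract_comp_subtype, LinearMap.lTensor_id]
  LinearEquiv.ofLinearMap
    (((retract s hs).lTensor A ∘ₗ coinvCurrent K L A).prod (coinvAb K L A))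
    ((currentSection A s hs ∘ₗ
      (symCoinvIdeal (⊤ : LieIdeal K L) (commutant K L)).subtype.lTensor A).coprod
        (abSection A s))
    (LinearMap.ext fun ⟨t, u⟩ => by
      have h1 := LinearMap.congr_fun hCurrent
        ((symCoinvIdeal (⊤ : LieIdeal K L) (commutant K L)).subtype.lTensor A t)
      have h2 := LinearMap.congr_fun hsub t
      have h3 := LinearMap.congr_fun hCurrentAb u
      have h4 := LinearMap.congr_fun hAb
        ((symCoinvIdeal (⊤ : LieIdeal K L) (commutant K L)).subtype.lTensor A t)
      have h5 := LinearMap.congr_fun hAbSection u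
      simp only [LinearMap.comp_apply, LinearMap.id_apply, LinearMap.zero_apply] at h1 h2 h3 h4 h5
      simp only [LinearMap.comp_apply, LinearMap.prod_apply, Function.prod, LinearMap.coprod_apply,
        map_add, h1, h2, h3, h4, h5, LinearMap.id_apply, Prod.mk_add_mk, add_zero, zero_add])
    (LinearMap.ext fun b => by
      have h1 := LinearMap.congr_fun hretract (coinvCurrent K L A b)
      have h2 := LinearMap.congr_fun hsplit b
      simp only [LinearMap.comp_apply, LinearMap.add_apply, LinearMap.id_apply] at h1 h2
      simp only [LinearMap.comp_apply, LinearMap.prod_apply, Function.prod, LinearMap.coprod_apply,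
        h1, h2, LinearMap.id_apply])

end Splitting

end Current

theorem theorem4p1 (K L A : Type*) [Field K] [LieRing L] [LieAlgebra K L]
    [CommRing A] [Algebra K A] :
    Nonempty (SymCoinv K (A ⊗[K] L) ≃ₗ[K]
      ((A ⊗[K] (symCoinvIdeal (⊤ : LieIdeal K L) (commutant K L))) ×
        SymSq K (A ⊗[K] (L ⧸ commutant K L)))) := by
  -- The field hypothesis enters here: a surjection of vector spaces splits.
  obtain ⟨s, hs⟩ := (abMk K L).exists_rightInverse_of_surjective
    (Submodule.range_mkQ _)
  exact ⟨coinvCurrentEquiv s (LinearMap.congr_fun hs)⟩
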